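/- Let $f:\mathbb{R}^n\to\mathbb{R}$ be $L$-smooth (differentiable everywhere, with $\|\nabla f(x)-\nabla f(y)\|\le L\|x-y\|$ for all $x,y$), let $h:\mathbb{R}^n\to\mathbb{R}$ be convex, and put $F=f+h$, where $\|\cdot\|$ is the Euclidean norm. For $\beta>0$ let $$\mathrm{prox}_{\beta F}(x)=\operatorname*{arg\,min}_{z}\ F(z)+\frac{1}{2\beta}\|x-z\|^2 ,$$ and let $$\partial F(x)=\{g\in\mathbb{R}^n:\ \langle v,g\rangle\le F^D(x;v)\ \ \forall v\},\qquad F^D(x;v)=\limsup_{y\to x,\ \rho\to 0^+}\frac{F(y+\rho v)-F(y)}{\rho},$$ be the Clarke subdifferential of $F$ at $x$. Then the following hold. 1. For every $x\in\mathbb{R}^n$ the minimizer $\mathrm{prox}_{\beta F}(x)$ exists and is unique for all sufficiently small $\beta>0$, and the limit $$V(x):=\lim_{\beta\to0^+}\frac{\mathrm{prox}_{\beta F}(x)-x}{\beta}$$ exists and belongs to $-\partial F(x)$. 2. A function $x$ with values in $\mathbb{R}^n$ is called a solution on $[0,T]$ of the proximal flow $\dot x=V(x)$ (respectively of the differential inclusion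 $\dot x\in-\partial F(x)$) if it is absolutely continuous on $[0,T]$ and, for almost every $t\in[0,T]$, is differentiable at $t$ with $\dot x(t)=V(x(t))$ (respectively $\dot x(t)\in-\partial F(x(t))$). For every $x_0\in\mathbb{R}^n$ there is $x:[0,\infty)\to\mathbb{R}^n$ with $x(0)=x_0$ that is, for every $T>0$, a solution on $[0,T]$ of the proximal flow and also of the differential inclusion. It is unique: for every $T>0$, every solution $y$ on $[0,T]$ of the proximal flow, or of the differential inclusion, with $y(0)=x_0$ satisfies $y(t)=x(t)$ for all $t\in[0,T]$. -/

import Mathlib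

namespace ProxFlow

/-- `f` is `L`-smooth on `ℝⁿ` (Euclidean norm): it is differentiable everywhere and its gradient
is `L`-Lipschitz. -/
def IsLSmooth {n : ℕ} (L : ℝ) (f : EuclideanSpace ℝ (Fin n) → ℝ) : Prop :=
  Differentiable ℝ f ∧ ∀ x y, ‖gradient f x - gradient f y‖ ≤ L * ‖x - y‖

/-- The set `argmin_z F(z) + ‖x - z‖² / (2 β)`. -/
def proxSet {n : ℕ} (F : EuclideanSpace ℝ (Fin n) → ℝ) (β : ℝ) (x : EuclideanSpace ℝ (Fin n)) :
    Set (EuclideanSpace ℝ (Fin n)) :=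
  {z | ∀ w, F z + 1 / (2 * β) * ‖x - z‖ ^ 2 ≤ F w + 1 / (2 * β) * ‖x - w‖ ^ 2}

/-- `v = lim_{β → 0⁺} (prox_{βF}(x) - x) / β`. It is part of the assertion that the minimizer
`prox_{βF}(x)` exists and is unique for all small `β > 0`, and that the limit exists. -/
def IsProxVelocity {n : ℕ} (F : EuclideanSpace ℝ (Fin n) → ℝ)
    (x v : EuclideanSpace ℝ (Fin n)) : Prop :=
  ∃ p : ℝ → EuclideanSpace ℝ (Fin n),
    (∀ᶠ β in nhdsWithin (0 : ℝ) (Set.Ioi 0), proxSet F β x = {p β}) ∧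
    Filter.Tendsto (fun β : ℝ => β⁻¹ • (p β - x)) (nhdsWithin (0 : ℝ) (Set.Ioi 0)) (nhds v)

/-- Clarke's generalized directional derivative
`limsup_{y → x, ρ → 0⁺} (F (y + ρ v) - F y) / ρ`, as an extended real number. -/
noncomputable def clarkeDeriv {n : ℕ} (F : EuclideanSpace ℝ (Fin n) → ℝ)
    (x v : EuclideanSpace ℝ (Fin n)) : EReal :=
  Filter.limsup
    (fun q : EuclideanSpace ℝ (Fin n) × ℝ =>
      (((F (q.1 + q.2 • v) - F q.1) / q.2 : ℝ) : EReal))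
    (nhds x ×ˢ nhdsWithin (0 : ℝ) (Set.Ioi 0))

/-- The Clarke subdifferential. -/
def clarkeSubdifferential {n : ℕ} (F : EuclideanSpace ℝ (Fin n) → ℝ)
    (x : EuclideanSpace ℝ (Fin n)) : Set (EuclideanSpace ℝ (Fin n)) :=
  {g | ∀ v, ((inner ℝ v g : ℝ) : EReal) ≤ clarkeDeriv F x v}

/-- `x` solves the proximal flow on `[0, T]`: it is absolutely continuous on `[0, T]` and, for
almost every `t ∈ [0, T]`, its derivative at `t` exists and equals
`lim_{β → 0⁺} (prox_{βF}(x(t)) - x(t)) / β`. -/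
def IsProximalFlowOn {n : ℕ} (F : EuclideanSpace ℝ (Fin n) → ℝ) (T : ℝ)
    (x : ℝ → EuclideanSpace ℝ (Fin n)) : Prop :=
  AbsolutelyContinuousOnInterval x 0 T ∧
  ∀ᵐ t ∂(MeasureTheory.volume.restrict (Set.Icc (0 : ℝ) T)),
    ∃ v, HasDerivAt x v t ∧ IsProxVelocity F (x t) v

/-- `x` solves the differential inclusion `x'(t) ∈ -∂F(x(t))` on `[0, T]`: it is absolutely
continuous on `[0, T]` and, for almost every `t ∈ [0, T]`, its derivative at `t` exists and
belongs to `-∂F(x(t))`. -/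
def IsSubgradientFlowOn {n : ℕ} (F : EuclideanSpace ℝ (Fin n) → ℝ) (T : ℝ)
    (x : ℝ → EuclideanSpace ℝ (Fin n)) : Prop :=
  AbsolutelyContinuousOnInterval x 0 T ∧
  ∀ᵐ t ∂(MeasureTheory.volume.restrict (Set.Icc (0 : ℝ) T)),
    ∃ v, HasDerivAt x v t ∧ -v ∈ clarkeSubdifferential F (x t)

end ProxFlow

/-! With K = |L|, the function F + K/2 ‖·‖² is convex, and only this weak convexity of F is used.
The Clarke subdifferential is then the set of slopes of touching minorants of curvature -K
(`clarkeSubdifferential_eq`): nonempty, closed, convex, hypomonotone and of closed graph.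

Let m be its element of least norm at x. For p = prox(x), the quotient (x - p)/β is a subgradient at
p, of norm at most ‖m‖/(1 - Kβ). Hence p → x, and every cluster point of the quotients is a
subgradient at x of norm at most ‖m‖, that is, m itself. So V(x) = -m (`isProxVelocity_neg`).

Uniqueness is hypomonotonicity and Grönwall applied to ‖y - x‖². For existence, the proximal point
algorithm satisfies uniform Lipschitz bounds and a discrete evolution variational inequality, and
both survive as the step tends to 0 (`exists_proximal_curve`). The inequality puts the velocity of
the limit in -∂F. The energy is monotone along the limit, hence differentiable almost everywhere,
and this forces the velocity to be -m (`neg_eq_minimal_of_hasDerivAt`). -/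

open Filter Topology MeasureTheory Set
open scoped RealInnerProductSpace NNReal

namespace ProxFlow

/-! ### Weakly convex functions and their subgradients. -/

section WeaklyConvex

variable {E : Type*} [NormedAddCommGroup E] [InnerProductSpace ℝ E]

/-- `F` is `K`-weakly convex: `F + K/2 ‖·‖²` is convex. -/
def IsWeaklyConvex (K : ℝ) (F : E → ℝ) : Prop :=
  ConvexOn ℝ univ fun x => F x + K / 2 * ‖x‖ ^ 2

/-- The subgradients of a `K`-weakly convex function at `x`: the slopes of the quadratic minorants
of `F` with curvature `-K` that touch `F` at `x`. -/
def weakSubdiff (K : ℝ) (F : E → ℝ) (x : E) : Set E :=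
  {g | ∀ z, F x + ⟪g, z - x⟫ - K / 2 * ‖z - x‖ ^ 2 ≤ F z}

lemma norm_add_smul_sq (x v : E) (t : ℝ) :
    ‖x + t • v‖ ^ 2 = ‖x‖ ^ 2 + 2 * t * ⟪x, v⟫ + t ^ 2 * ‖v‖ ^ 2 := by
  rw [norm_add_sq_real, inner_smul_right, norm_smul, mul_pow, Real.norm_eq_abs, sq_abs]
  ring

lemma IsWeaklyConvex.map_add_smul_le {K : ℝ} {F : E → ℝ} (hF : IsWeaklyConvex K F) (x v : E)
    {t : ℝ} (h0 : 0 ≤ t) (h1 : t ≤ 1) :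
    F (x + t • v) ≤ F x + t * (F (x + v) - F x) + K / 2 * (t * (1 - t)) * ‖v‖ ^ 2 := by
  have h := hF.2 (mem_univ x) (mem_univ (x + v)) (sub_nonneg.2 h1) h0 (by ring)
  have e : (1 - t) • x + t • (x + v) = x + t • v := by module
  rw [e] at h
  have h2 := norm_add_smul_sq x v t
  have h3 := norm_add_sq_real x v
  simp only [smul_eq_mul, h2, h3] at h
  linarith

/-- The subdifferential of a weakly convex function is hypomonotone. -/
lemma inner_sub_le_of_mem_weakSubdiff {K : ℝ} {F : E → ℝ} {x y g k : E}
    (hg : g ∈ weakSubdiff K F x) (hk : k ∈ weakSubdiff K F y) :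
    -(K * ‖x - y‖ ^ 2) ≤ ⟪g - k, x - y⟫ := by
  have h1 := hg y
  have h2 := hk x
  rw [norm_sub_rev, ← neg_sub x y, inner_neg_right] at h1
  rw [inner_sub_left]
  linarith

lemma convex_weakSubdiff (K : ℝ) (F : E → ℝ) (x : E) : Convex ℝ (weakSubdiff K F x) := by
  intro g hg k hk a b ha hb hab z
  have h1 := mul_le_mul_of_nonneg_left (hg z) ha
  have h2 := mul_le_mul_of_nonneg_left (hk z) hb
  obtain rfl : b = 1 - a := by linarith
  rw [inner_add_left, inner_smul_left, inner_smul_left]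
  simp only [conj_trivial]
  linarith

lemma isClosed_graph_weakSubdiff {K : ℝ} {F : E → ℝ} (hF : Continuous F) :
    IsClosed {p : E × E | p.2 ∈ weakSubdiff K F p.1} := by
  have e : {p : E × E | p.2 ∈ weakSubdiff K F p.1} =
      ⋂ z, {p : E × E | F p.1 + ⟪p.2, z - p.1⟫ - K / 2 * ‖z - p.1‖ ^ 2 ≤ F z} := by
    ext p
    simp [weakSubdiff]
  rw [e]
  exact isClosed_iInter fun z => isClosed_le (by fun_prop) (by fun_prop)

lemma isClosed_weakSubdiff {K : ℝ} {F : E → ℝ} (hF : Continuous F) (x : E) :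
    IsClosed (weakSubdiff K F x) :=
  (isClosed_graph_weakSubdiff (K := K) hF).preimage (by fun_prop : Continuous fun g : E => (x, g))

/-- A convex continuous function has a supporting affine functional at every point. -/
lemma exists_subgradient [CompleteSpace E] {G : E → ℝ} (hG : ConvexOn ℝ univ G)
    (hc : Continuous G) (x : E) : ∃ g : E, ∀ z, G x + ⟪g, z - x⟫ ≤ G z := by
  have hopen : IsOpen {p : E × ℝ | p.1 ∈ univ ∧ G p.1 < p.2} := by
    simp only [mem_univ, true_and]
    exact isOpen_lt (by fun_prop) (by fun_prop)
  -- The point (x, G x) is separated from the open strict epigraph. The functional is not vertical,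
  -- because (x, G x + 1) lies in the epigraph; dividing by -c gives the slope.
  obtain ⟨l, hl⟩ := geometric_hahn_banach_open_point hG.convex_strict_epigraph hopen
    (x := (x, G x)) (by simp)
  set c := l (0, 1) with hc'
  have hsplit : ∀ (y : E) (s : ℝ), l (y, s) = l (y, 0) + s * c := by
    intro y s
    have : (y, s) = (y, (0 : ℝ)) + s • ((0 : E), (1 : ℝ)) := by simp
    rw [this, map_add, map_smul, smul_eq_mul]
  have hneg : c < 0 := by
    have := hl (x, G x + 1) (by simp)
    rw [hsplit, hsplit x (G x)] at this
    linarith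
  have hle : ∀ z, l (z, 0) + G z * c ≤ l (x, 0) + G x * c := by
    intro z
    refine le_of_forall_pos_lt_add fun ε hε => ?_
    have := hl (z, G z + ε / (-c)) (by simp; exact div_pos hε (by linarith))
    rw [hsplit, hsplit x (G x), add_mul] at this
    have e : ε / (-c) * c = -ε := by rw [div_neg, neg_mul, div_mul_cancel₀ _ hneg.ne]
    rw [e] at this
    linarith
  let u : E →L[ℝ] ℝ := (-c)⁻¹ • l.comp (ContinuousLinearMap.inl ℝ E ℝ)
  refine ⟨(InnerProductSpace.toDual ℝ E).symm u, fun z => ?_⟩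
  rw [InnerProductSpace.toDual_symm_apply]
  have h1 : l (z - x, 0) = l (z, 0) - l (x, 0) := by
    rw [← map_sub]; simp
  have h2 : u (z - x) = (-c)⁻¹ * (l (z, 0) - l (x, 0)) := by
    simp [u, h1]
  rw [h2, ← le_sub_iff_add_le', inv_mul_le_iff₀ (by linarith)]
  have := hle z
  linarith

variable [FiniteDimensional ℝ E]

lemma IsWeaklyConvex.continuous {K : ℝ} {F : E → ℝ} (hF : IsWeaklyConvex K F) : Continuous F := by
  have h := hF.locallyLipschitz.continuous
  have e : F = fun x => (F x + K / 2 * ‖x‖ ^ 2) - K / 2 * ‖x‖ ^ 2 := by ext x; ring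
  rw [e]
  exact h.sub (by fun_prop)

lemma IsWeaklyConvex.nonempty_weakSubdiff {K : ℝ} {F : E → ℝ} (hF : IsWeaklyConvex K F) (x : E) :
    (weakSubdiff K F x).Nonempty := by
  obtain ⟨g, hg⟩ := exists_subgradient hF hF.locallyLipschitz.continuous x
  refine ⟨g - K • x, fun z => ?_⟩
  have h := hg z
  have e := norm_add_sq_real x (z - x)
  rw [add_sub_cancel] at e
  rw [inner_sub_left, inner_smul_left, conj_trivial]
  rw [e] at h
  linarith

/-- The element of minimal norm of the subdifferential. -/
lemma IsWeaklyConvex.exists_minimal {K : ℝ} {F : E → ℝ} (hF : IsWeaklyConvex K F) (x : E) :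
    ∃ m ∈ weakSubdiff K F x, ∀ g ∈ weakSubdiff K F x, ‖m‖ ^ 2 ≤ ⟪m, g⟫ := by
  have hconv := convex_weakSubdiff K F x
  obtain ⟨m, hm, h⟩ := exists_norm_eq_iInf_of_complete_convex (hF.nonempty_weakSubdiff x)
    (isClosed_weakSubdiff hF.continuous x).isComplete hconv 0
  refine ⟨m, hm, fun g hg => ?_⟩
  have := (norm_eq_iInf_iff_real_inner_le_zero hconv hm).1 h g hg
  rw [zero_sub, inner_neg_left, inner_sub_right, real_inner_self_eq_norm_sq] at this
  linarith

end WeaklyConvex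

/-! ### The proximal map of a weakly convex function. -/

section Proximal

variable {E : Type*} [NormedAddCommGroup E] [InnerProductSpace ℝ E]

/-- First-order optimality: compare z with z + t (w - z), divide by t and let t → 0⁺. -/
lemma smul_sub_mem_weakSubdiff_of_isMin {K β : ℝ} {F : E → ℝ} (hF : IsWeaklyConvex K F)
    {x z : E}
    (hz : ∀ w, F z + 1 / (2 * β) * ‖x - z‖ ^ 2 ≤ F w + 1 / (2 * β) * ‖x - w‖ ^ 2) :
    β⁻¹ • (x - z) ∈ weakSubdiff K F z := by
  intro w
  set v := w - z with hv
  have hw : w = z + v := by rw [hv]; abel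
  have key : ∀ t ∈ Ioo (0 : ℝ) 1, ⟪β⁻¹ • (x - z), v⟫ ≤
      F w - F z + K / 2 * (1 - t) * ‖v‖ ^ 2 + t * (1 / (2 * β) * ‖v‖ ^ 2) := by
    intro t ht
    have h1 := hz (z + t • v)
    have h2 := hF.map_add_smul_le z v ht.1.le ht.2.le
    have e : x - (z + t • v) = (x - z) + (-t) • v := by module
    rw [e, norm_add_smul_sq] at h1
    rw [← hw] at h2
    rw [inner_smul_left, conj_trivial]
    have h3 : t * (β⁻¹ * ⟪x - z, v⟫) ≤
        t * (F w - F z + K / 2 * (1 - t) * ‖v‖ ^ 2 + t * (1 / (2 * β) * ‖v‖ ^ 2)) := by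
      have e2 : 1 / (2 * β) * (‖x - z‖ ^ 2 + 2 * -t * ⟪x - z, v⟫ + (-t) ^ 2 * ‖v‖ ^ 2) =
        1 / (2 * β) * ‖x - z‖ ^ 2 - t * (β⁻¹ * ⟪x - z, v⟫) +
          t * (t * (1 / (2 * β) * ‖v‖ ^ 2)) := by
        rw [one_div, mul_inv]; ring
      rw [e2] at h1
      linarith
    exact le_of_mul_le_mul_left h3 ht.1
  have hlim : Tendsto (fun t : ℝ => F w - F z + K / 2 * (1 - t) * ‖v‖ ^ 2 +
      t * (1 / (2 * β) * ‖v‖ ^ 2)) (𝓝[>] 0) (𝓝 (F w - F z + K / 2 * (1 - 0) * ‖v‖ ^ 2 +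
      0 * (1 / (2 * β) * ‖v‖ ^ 2))) :=
    tendsto_nhdsWithin_of_tendsto_nhds (Continuous.tendsto (by fun_prop) 0)
  have := ge_of_tendsto hlim (Filter.mem_of_superset (Ioo_mem_nhdsGT zero_lt_one) key)
  linarith

/-- A proximal step does not increase the norm of subgradients, up to the factor `1 - K β`. -/
lemma norm_smul_sub_le {K β : ℝ} (hβ : 0 < β) {F : E → ℝ} {x z g : E}
    (hz : β⁻¹ • (x - z) ∈ weakSubdiff K F z) (hg : g ∈ weakSubdiff K F x) :
    (1 - K * β) * ‖β⁻¹ • (x - z)‖ ≤ ‖g‖ := by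
  set k := β⁻¹ • (x - z) with hk
  have hxz : z - x = -(β • k) := by
    rw [hk, smul_smul, mul_inv_cancel₀ hβ.ne', one_smul]; abel
  have h := inner_sub_le_of_mem_weakSubdiff hz hg
  rw [hxz, inner_neg_right, inner_smul_right, inner_sub_left, real_inner_self_eq_norm_sq,
    norm_neg, norm_smul, Real.norm_of_nonneg hβ.le] at h
  have h1 : β * ((1 - K * β) * ‖k‖ ^ 2) ≤ β * ⟪g, k⟫ := by linarith
  have h2 := le_of_mul_le_mul_left h1 hβ
  have h3 := real_inner_le_norm g k
  rcases (norm_nonneg k).eq_or_lt with h0 | h0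
  · rw [← h0, mul_zero]; exact norm_nonneg g
  · refine le_of_mul_le_mul_right ?_ h0
    linarith

lemma eq_of_smul_sub_mem_weakSubdiff {K β : ℝ} (hβ : 0 < β) (hK : K * β < 1) {F : E → ℝ}
    {x z w : E} (hz : β⁻¹ • (x - z) ∈ weakSubdiff K F z)
    (hw : β⁻¹ • (x - w) ∈ weakSubdiff K F w) : z = w := by
  have h := inner_sub_le_of_mem_weakSubdiff hz hw
  have e : β⁻¹ • (x - z) - β⁻¹ • (x - w) = -(β⁻¹ • (z - w)) := by module
  rw [e, inner_neg_left, inner_smul_left, conj_trivial, real_inner_self_eq_norm_sq] at h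
  have h1 : (β⁻¹ - K) * ‖z - w‖ ^ 2 ≤ 0 := by linarith
  have h2 : 0 < β⁻¹ - K := by
    rw [sub_pos, ← one_div, lt_div_iff₀ hβ]; exact hK
  have h3 : ‖z - w‖ ^ 2 ≤ 0 := nonpos_of_mul_nonpos_right h1 h2
  rw [← sub_eq_zero, ← norm_eq_zero]
  exact pow_eq_zero_iff two_ne_zero |>.1 (le_antisymm h3 (sq_nonneg _))

/-- Coercivity: F has a minorant of curvature -K, and the proximal term has curvature 1/β > K. -/
lemma IsWeaklyConvex.exists_isMin [FiniteDimensional ℝ E] {K β : ℝ} {F : E → ℝ}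
    (hF : IsWeaklyConvex K F) (hβ : 0 < β) (hK : K * β < 1) (x : E) :
    ∃ z, ∀ w, F z + 1 / (2 * β) * ‖x - z‖ ^ 2 ≤ F w + 1 / (2 * β) * ‖x - w‖ ^ 2 := by
  obtain ⟨g, hg⟩ := hF.nonempty_weakSubdiff x
  have hcont := hF.continuous
  refine Continuous.exists_forall_le (f := fun z => F z + 1 / (2 * β) * ‖x - z‖ ^ 2)
    (by fun_prop) ?_
  set a := (1 / (2 * β) - K / 2) with ha
  have ha0 : 0 < a := by
    rw [ha, sub_pos, div_lt_div_iff₀ (by norm_num) (by linarith)]; linarith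
  have h1 : Tendsto (fun z : E => ‖z - x‖) (cocompact E) atTop := by
    have := tendsto_norm_cocompact_atTop (E := E)
    exact this.comp (Homeomorph.subRight x).isClosedEmbedding.tendsto_cocompact
  have h2 : Tendsto (fun r : ℝ => F x + r * (a * r + -‖g‖)) atTop atTop :=
    tendsto_atTop_add_const_left _ _ (tendsto_id.atTop_mul_atTop₀
      (tendsto_atTop_add_const_right _ _ (tendsto_id.const_mul_atTop ha0)))
  refine tendsto_atTop_mono (fun z => ?_) (h2.comp h1)
  have h3 := hg z
  have h4 := neg_le_of_abs_le (abs_real_inner_le_norm g (z - x))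
  rw [norm_sub_rev x z, ha, Function.comp_apply]
  linarith

end Proximal

/-! ### Clarke subdifferential and proximal velocity. -/

section Clarke

variable {n : ℕ}

local notation "𝔼" => EuclideanSpace ℝ (Fin n)

/-- Weak convexity bounds the difference quotient at any base point y, for steps in (0, 1), by F (y
+ v) - F y plus a quadratic error, which is continuous in y. Conversely, the limsup is at least its
restriction to y = x, where the minorant bounds the quotient from below. -/
lemma IsWeaklyConvex.clarkeSubdifferential_eq {K : ℝ} {F : 𝔼 → ℝ} (hF : IsWeaklyConvex K F)
    (x : 𝔼) : clarkeSubdifferential F x = weakSubdiff K F x := by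
  have hcont := hF.continuous
  ext g
  constructor
  · intro hg z
    set v := z - x with hv
    have hz : z = x + v := by rw [hv]; abel
    suffices h : clarkeDeriv F x v ≤ ((F z - F x + K / 2 * ‖v‖ ^ 2 : ℝ) : EReal) by
      have h2 := EReal.coe_le_coe_iff.1 ((hg v).trans h)
      rw [real_inner_comm] at h2
      linarith
    have hlim : Tendsto (fun q : 𝔼 × ℝ =>
        ((F (q.1 + v) - F q.1 + K / 2 * (1 - q.2) * ‖v‖ ^ 2 : ℝ) : EReal))
        (𝓝 x ×ˢ 𝓝[>] (0 : ℝ)) (𝓝 ((F z - F x + K / 2 * ‖v‖ ^ 2 : ℝ) : EReal)) := by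
      refine (continuous_coe_real_ereal.tendsto _).comp ?_
      have h := Continuous.tendsto (f := fun q : 𝔼 × ℝ =>
        F (q.1 + v) - F q.1 + K / 2 * (1 - q.2) * ‖v‖ ^ 2) (by fun_prop) (x, 0)
      rw [← hz, sub_zero, mul_one] at h
      refine h.mono_left ?_
      rw [nhds_prod_eq]
      exact Filter.prod_mono le_rfl nhdsWithin_le_nhds
    rw [clarkeDeriv, ← hlim.limsup_eq]
    refine limsup_le_limsup ?_
    filter_upwards [prod_mem_prod (univ_mem (f := 𝓝 x)) (Ioo_mem_nhdsGT (zero_lt_one (α := ℝ)))]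
      with q hq
    have hq2 := hq.2
    rw [EReal.coe_le_coe_iff, div_le_iff₀ hq2.1]
    have := hF.map_add_smul_le q.1 v hq2.1.le hq2.2.le
    linarith
  · intro hg v
    have hlim : Tendsto (fun ρ : ℝ => ((⟪v, g⟫ - K / 2 * ρ * ‖v‖ ^ 2 : ℝ) : EReal))
        (𝓝[>] (0 : ℝ)) (𝓝 ((⟪v, g⟫ : ℝ) : EReal)) := by
      refine (continuous_coe_real_ereal.tendsto _).comp ?_
      have h := Continuous.tendsto (f := fun ρ : ℝ => ⟪v, g⟫ - K / 2 * ρ * ‖v‖ ^ 2)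
        (by fun_prop) 0
      rw [mul_zero, zero_mul, sub_zero] at h
      exact h.mono_left nhdsWithin_le_nhds
    have hle : Filter.map (fun ρ : ℝ => (x, ρ)) (𝓝[>] (0 : ℝ)) ≤ 𝓝 x ×ˢ 𝓝[>] (0 : ℝ) :=
      tendsto_const_nhds.prodMk tendsto_id
    refine le_trans ?_ (limsup_le_limsup_of_le hle)
    rw [← hlim.limsup_eq, ← Filter.limsup_comp]
    refine limsup_le_limsup ?_
    filter_upwards [self_mem_nhdsWithin] with ρ hρ
    rw [mem_Ioi] at hρ
    rw [Function.comp_apply, EReal.coe_le_coe_iff, le_div_iff₀ hρ]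
    have := hg (x + ρ • v)
    rw [add_sub_cancel_left, inner_smul_right, norm_smul, mul_pow, Real.norm_eq_abs, sq_abs,
      real_inner_comm] at this
    linarith

/-- The proximal velocity of a weakly convex function is the opposite of the subgradient of
minimal norm. -/
lemma IsWeaklyConvex.isProxVelocity_neg {K : ℝ} {F : 𝔼 → ℝ} (hF : IsWeaklyConvex K F) {x m : 𝔼}
    (hm : m ∈ weakSubdiff K F x) (hmin : ∀ g ∈ weakSubdiff K F x, ‖m‖ ^ 2 ≤ ⟪m, g⟫) :
    IsProxVelocity F x (-m) := by
  have hex : ∀ β : ℝ, ∃ z, 0 < β ∧ K * β < 1 → z ∈ proxSet F β x := by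
    intro β
    by_cases h : 0 < β ∧ K * β < 1
    · obtain ⟨z, hz⟩ := hF.exists_isMin h.1 h.2 x
      exact ⟨z, fun _ => hz⟩
    · exact ⟨0, fun h' => absurd h' h⟩
  choose p hp using hex
  have hKβ : Tendsto (fun β : ℝ => K * β) (𝓝[>] 0) (𝓝 0) := by
    have h := Continuous.tendsto (f := fun β : ℝ => K * β) (by fun_prop) 0
    rw [mul_zero] at h
    exact h.mono_left nhdsWithin_le_nhds
  have hsmall : ∀ᶠ β in 𝓝[>] (0 : ℝ), 0 < β ∧ K * β < 1 / 2 :=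
    (eventually_mem_nhdsWithin (a := (0 : ℝ)) (s := Ioi 0)).and
      (hKβ.eventually_lt_const (by norm_num))
  set k : ℝ → 𝔼 := fun β => β⁻¹ • (x - p β) with hk
  have hkmem : ∀ β : ℝ, 0 < β ∧ K * β < 1 / 2 → k β ∈ weakSubdiff K F (p β) := fun β hβ =>
    smul_sub_mem_weakSubdiff_of_isMin hF (hp β ⟨hβ.1, by linarith⟩)
  have hknorm : ∀ β : ℝ, 0 < β ∧ K * β < 1 / 2 → (1 - K * β) * ‖k β‖ ≤ ‖m‖ := fun β hβ =>
    norm_smul_sub_le hβ.1 (hkmem β hβ) hm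
  -- The factor 2 comes from K β < 1/2, so that 1 - K β > 1/2.
  have hkbdd : ∀ᶠ β in 𝓝[>] (0 : ℝ), k β ∈ Metric.closedBall (0 : 𝔼) (2 * ‖m‖) := by
    filter_upwards [hsmall] with β hβ
    rw [mem_closedBall_zero_iff]
    nlinarith [hknorm β hβ, norm_nonneg (k β)]
  have hβ0 : Tendsto (fun β : ℝ => β) (𝓝[>] 0) (𝓝 0) := nhdsWithin_le_nhds
  have hpx : Tendsto p (𝓝[>] 0) (𝓝 x) := by
    rw [tendsto_iff_norm_sub_tendsto_zero]
    have h2 : Tendsto (fun β : ℝ => β * (2 * ‖m‖)) (𝓝[>] 0) (𝓝 0) := by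
      simpa using hβ0.mul_const (2 * ‖m‖)
    refine squeeze_zero' (Eventually.of_forall fun _ => norm_nonneg _) ?_ h2
    filter_upwards [hkbdd, hsmall] with β h1 hβ
    rw [mem_closedBall_zero_iff, hk, norm_smul, norm_inv, Real.norm_of_nonneg hβ.1.le,
      inv_mul_le_iff₀ hβ.1, norm_sub_rev] at h1
    exact h1
  refine ⟨p, ?_, ?_⟩
  · filter_upwards [hsmall] with β hβ
    refine (Set.eq_singleton_iff_unique_mem).2 ⟨hp β ⟨hβ.1, by linarith⟩, fun z hz => ?_⟩
    exact eq_of_smul_sub_mem_weakSubdiff hβ.1 (by linarith : K * β < 1)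
      (smul_sub_mem_weakSubdiff_of_isMin hF hz) (hkmem β hβ)
  -- By compactness it is enough that m is the only possible cluster point.
  · have hklim : Tendsto k (𝓝[>] 0) (𝓝 m) := by
      refine (isCompact_closedBall (0 : 𝔼) (2 * ‖m‖)).tendsto_nhds_of_unique_mapClusterPt hkbdd ?_
      intro g _ hg
      obtain ⟨U, hU, hUg⟩ := mapClusterPt_iff_ultrafilter.1 hg
      have hgx : g ∈ weakSubdiff K F x :=
        (isClosed_graph_weakSubdiff (K := K) hF.continuous).mem_of_tendsto
          ((hpx.mono_left hU).prodMk_nhds hUg)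
          ((hsmall.mono fun β hβ => hkmem β hβ).filter_mono hU)
      have hgm : ‖g‖ ≤ ‖m‖ := by
        have h1 : Tendsto (fun β => (1 - K * β) * ‖k β‖) U (𝓝 ((1 - 0) * ‖g‖)) :=
          ((hKβ.mono_left hU).const_sub 1).mul hUg.norm
        have := le_of_tendsto h1 ((hsmall.mono fun β hβ => hknorm β hβ).filter_mono hU)
        linarith
      have h1 := hmin g hgx
      have h2 := norm_sub_sq_real g m
      rw [real_inner_comm] at h2
      have h3 : ‖g - m‖ ^ 2 ≤ 0 := by
        have : ‖g‖ ^ 2 ≤ ‖m‖ ^ 2 := by gcongr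
        linarith
      rw [← sub_eq_zero, ← norm_eq_zero]
      exact pow_eq_zero_iff two_ne_zero |>.1 (le_antisymm h3 (sq_nonneg _))
    refine hklim.neg.congr fun β => ?_
    rw [hk, ← smul_neg, neg_sub]

/-- The proximal velocity is unique. -/
lemma IsProxVelocity.unique {F : 𝔼 → ℝ} {x v w : 𝔼} (hv : IsProxVelocity F x v)
    (hw : IsProxVelocity F x w) : v = w := by
  obtain ⟨p, hp, hpv⟩ := hv
  obtain ⟨q, hq, hqw⟩ := hw
  refine tendsto_nhds_unique hpv (hqw.congr' ?_)
  filter_upwards [hp, hq] with β h1 h2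
  rw [Set.singleton_injective (h1.symm.trans h2)]

lemma IsWeaklyConvex.neg_mem_of_isProxVelocity {K : ℝ} {F : 𝔼 → ℝ} (hF : IsWeaklyConvex K F)
    {x v : 𝔼} (hv : IsProxVelocity F x v) : -v ∈ clarkeSubdifferential F x := by
  obtain ⟨m, hm, hmin⟩ := hF.exists_minimal x
  rw [hv.unique (hF.isProxVelocity_neg hm hmin), neg_neg, hF.clarkeSubdifferential_eq]
  exact hm

lemma IsProximalFlowOn.isSubgradientFlowOn {K : ℝ} {F : 𝔼 → ℝ} (hF : IsWeaklyConvex K F) {T : ℝ}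
    {x : ℝ → 𝔼} (hx : IsProximalFlowOn F T x) : IsSubgradientFlowOn F T x := by
  refine ⟨hx.1, hx.2.mono ?_⟩
  rintro t ⟨v, hv, hp⟩
  exact ⟨v, hv, hF.neg_mem_of_isProxVelocity hp⟩

end Clarke

/-! ### Uniqueness of the flow. -/

section Uniqueness

lemma _root_.AbsolutelyContinuousOnInterval.norm' {F : Type*} [NormedAddCommGroup F]
    {f : ℝ → F} {a b : ℝ} (hf : AbsolutelyContinuousOnInterval f a b) :
    AbsolutelyContinuousOnInterval (fun t => ‖f t‖) a b := by
  refine squeeze_zero (fun t => Finset.sum_nonneg fun i _ => dist_nonneg) (fun t => ?_) hf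
  exact Finset.sum_le_sum fun i _ => by
    rw [Real.dist_eq, dist_eq_norm]; exact abs_norm_sub_norm_le _ _

/-- Grönwall's inequality for absolutely continuous functions. -/
lemma le_zero_of_ae_deriv_le {u : ℝ → ℝ} {T C : ℝ} (hT : 0 ≤ T)
    (hu : AbsolutelyContinuousOnInterval u 0 T) (h0 : u 0 = 0)
    (h : ∀ᵐ t, t ∈ Icc 0 T → ∃ d, HasDerivAt u d t ∧ d ≤ C * u t) : u T ≤ 0 := by
  have hexp : AbsolutelyContinuousOnInterval (fun t => Real.exp (-C * t)) 0 T := by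
    have hc : ContDiffOn ℝ 1 (fun t : ℝ => Real.exp (-C * t)) (uIcc 0 T) := by fun_prop
    obtain ⟨M, hM⟩ := hc.exists_lipschitzOnWith (by decide) (convex_uIcc _ _) isCompact_uIcc
    exact hM.absolutelyContinuousOnInterval
  have hv := hexp.fun_mul hu
  have hint := hv.integral_deriv_eq_sub
  -- The product exp (-C t) u t is absolutely continuous, so it is the integral of its nonpositive
  -- derivative.
  have hle : ∫ t in (0 : ℝ)..T, deriv (fun t => Real.exp (-C * t) * u t) t ≤ 0 := by
    rw [intervalIntegral.integral_of_le hT]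
    refine integral_nonpos_of_ae ?_
    rw [EventuallyLE, ae_restrict_iff' measurableSet_Ioc]
    filter_upwards [h] with t ht hmem
    obtain ⟨d, hd, hdle⟩ := ht (Ioc_subset_Icc_self hmem)
    have h1 : HasDerivAt (fun t : ℝ => Real.exp (-C * t)) (Real.exp (-C * t) * (-C)) t := by
      simpa using ((hasDerivAt_id t).const_mul (-C)).exp
    rw [(h1.fun_mul hd).deriv, Pi.zero_apply]
    have : Real.exp (-C * t) * (d - C * u t) ≤ 0 :=
      mul_nonpos_of_nonneg_of_nonpos (Real.exp_pos _).le (by linarith)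
    linarith
  rw [hint, h0, mul_zero, sub_zero] at hle
  exact nonpos_of_mul_nonpos_right hle (Real.exp_pos _)

lemma IsSubgradientFlowOn.eqOn {n : ℕ} {K T : ℝ} {F : EuclideanSpace ℝ (Fin n) → ℝ}
    (hF : IsWeaklyConvex K F) {x y : ℝ → EuclideanSpace ℝ (Fin n)}
    (hx : IsSubgradientFlowOn F T x) (hy : IsSubgradientFlowOn F T y) (h0 : y 0 = x 0) :
    EqOn y x (Icc 0 T) := by
  intro t ht
  have hsub : uIcc 0 t ⊆ uIcc 0 T := by
    rw [uIcc_of_le ht.1, uIcc_of_le (ht.1.trans ht.2)]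
    exact Icc_subset_Icc_right ht.2
  have hac := ((hy.1.fun_sub hx.1).mono hsub).norm'
  have hac2 := hac.fun_mul hac
  have hae : ∀ᵐ s, s ∈ Icc 0 t → ∃ d, HasDerivAt (fun s => ‖y s - x s‖ * ‖y s - x s‖) d s ∧
      d ≤ 2 * K * (‖y s - x s‖ * ‖y s - x s‖) := by
    have hx2 := hx.2
    have hy2 := hy.2
    rw [ae_restrict_iff' measurableSet_Icc] at hx2 hy2
    filter_upwards [hx2, hy2] with s h1 h2 hs
    have hs' : s ∈ Icc 0 T := ⟨hs.1, hs.2.trans ht.2⟩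
    obtain ⟨v, hv, hvm⟩ := h1 hs'
    obtain ⟨w, hw, hwm⟩ := h2 hs'
    rw [hF.clarkeSubdifferential_eq] at hvm hwm
    refine ⟨2 * ⟪y s - x s, w - v⟫, ?_, ?_⟩
    · have := (hw.fun_sub hv).norm_sq
      simpa only [← sq] using this
    · have := inner_sub_le_of_mem_weakSubdiff hwm hvm
      have e : -w - -v = -(w - v) := by abel
      rw [e, inner_neg_left, real_inner_comm] at this
      rw [← sq]
      linarith
  have := le_zero_of_ae_deriv_le ht.1 hac2 (by simp [h0]) hae
  have h1 : ‖y t - x t‖ = 0 := by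
    rw [← mul_self_eq_zero]
    exact le_antisymm this (mul_self_nonneg _)
  exact sub_eq_zero.1 (norm_eq_zero.1 h1)

end Uniqueness

/-! ### The proximal point algorithm and its continuous limit. -/

section ProximalSequence

variable {E : Type*} [NormedAddCommGroup E] [InnerProductSpace ℝ E]

/-- A sequence of points generated by the proximal point algorithm with step `τ`. -/
structure IsProximalSequence (K τ : ℝ) (F : E → ℝ) (X : ℕ → E) : Prop where
  mem (j : ℕ) : τ⁻¹ • (X j - X (j + 1)) ∈ weakSubdiff K F (X (j + 1))
  le (j : ℕ) : F (X (j + 1)) ≤ F (X j)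

lemma IsWeaklyConvex.exists_isProximalSequence [FiniteDimensional ℝ E] {K τ : ℝ} {F : E → ℝ}
    (hF : IsWeaklyConvex K F) (hτ : 0 < τ) (hK : K * τ < 1) (x₀ : E) :
    ∃ X : ℕ → E, X 0 = x₀ ∧ IsProximalSequence K τ F X := by
  choose J hJ using hF.exists_isMin hτ hK
  refine ⟨fun j => J^[j] x₀, rfl, fun j => ?_, fun j => ?_⟩
  · rw [Function.iterate_succ_apply']
    exact smul_sub_mem_weakSubdiff_of_isMin hF (hJ _)
  · rw [Function.iterate_succ_apply']
    have h := hJ (J^[j] x₀) (J^[j] x₀)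
    rw [sub_self, norm_zero] at h
    have : 0 ≤ 1 / (2 * τ) * ‖J^[j] x₀ - J (J^[j] x₀)‖ ^ 2 := by positivity
    linarith

namespace IsProximalSequence

variable {K τ : ℝ} {F : E → ℝ} {X : ℕ → E}

/-- Each step multiplies the subgradient norm by at most 1/(1 - Kτ), which is at most exp (2Kτ) when
Kτ ≤ 1/2. -/
lemma norm_smul_sub_le_exp (hX : IsProximalSequence K τ F X) (hK : 0 ≤ K) (hτ : 0 < τ)
    (hKτ : 2 * K * τ ≤ 1) {g : E} (hg : g ∈ weakSubdiff K F (X 0)) (j : ℕ) :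
    ‖τ⁻¹ • (X j - X (j + 1))‖ ≤ ‖g‖ * Real.exp (2 * K * τ * (j + 1 : ℕ)) := by
  have ha : 0 ≤ K * τ := by positivity
  have hexp : 1 ≤ (1 - K * τ) * Real.exp (2 * K * τ) := by
    have h1 := Real.add_one_le_exp (2 * K * τ)
    nlinarith
  have hstep : ∀ r s : ℝ, 0 ≤ r → (1 - K * τ) * r ≤ s → r ≤ s * Real.exp (2 * K * τ) := by
    intro r s hr h
    have h2 := mul_le_mul_of_nonneg_right h (Real.exp_pos (2 * K * τ)).le
    have h3 := mul_le_mul_of_nonneg_right hexp hr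
    linarith
  induction j with
  | zero =>
    simpa using hstep _ _ (norm_nonneg _) (norm_smul_sub_le hτ (hX.mem 0) hg)
  | succ j ih =>
    have h := hstep _ _ (norm_nonneg _) (norm_smul_sub_le hτ (hX.mem (j + 1)) (hX.mem j))
    refine h.trans ((mul_le_mul_of_nonneg_right ih (Real.exp_pos _).le).trans (le_of_eq ?_))
    rw [mul_assoc, ← Real.exp_add]
    congr 2
    push_cast
    ring

lemma norm_sub_le (hX : IsProximalSequence K τ F X) (hK : 0 ≤ K) (hτ : 0 < τ)
    (hKτ : 2 * K * τ ≤ 1) {g : E} (hg : g ∈ weakSubdiff K F (X 0)) {i j : ℕ} (hij : i ≤ j) :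
    ‖X j - X i‖ ≤ (j * τ - i * τ) * (‖g‖ * Real.exp (2 * K * (j * τ))) := by
  induction j, hij using Nat.le_induction with
  | base => simp
  | succ j hij ih =>
    have h1 := hX.norm_smul_sub_le_exp hK hτ hKτ hg j
    rw [norm_smul, norm_inv, Real.norm_of_nonneg hτ.le, inv_mul_le_iff₀ hτ, norm_sub_rev] at h1
    have e : 2 * K * τ * (j + 1 : ℕ) = 2 * K * ((j + 1 : ℕ) * τ) := by ring
    rw [e] at h1
    have h2 : Real.exp (2 * K * (j * τ)) ≤ Real.exp (2 * K * ((j + 1 : ℕ) * τ)) := by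
      gcongr
      simp
    have h3 : (0 : ℝ) ≤ j * τ - i * τ := by
      rw [← sub_mul]
      exact mul_nonneg (sub_nonneg.2 (Nat.cast_le.2 hij)) hτ.le
    have h4 := mul_le_mul_of_nonneg_left (mul_le_mul_of_nonneg_left h2 (norm_nonneg g)) h3
    have h5 := norm_sub_le_norm_sub_add_norm_sub (X (j + 1)) (X j) (X i)
    have e2 : ((j + 1 : ℕ) * τ - i * τ : ℝ) = τ + (j * τ - i * τ) := by push_cast; ring
    rw [e2, add_mul]
    linarith

/-- The discrete evolution variational inequality. -/
lemma half_norm_sq_sub_le (hX : IsProximalSequence K τ F X) (hτ : 0 < τ) {z : E} {A : ℝ}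
    {i j : ℕ} (hij : i ≤ j)
    (hA : ∀ k, i ≤ k → k ≤ j → F z - F (X k) + K / 2 * ‖z - X k‖ ^ 2 ≤ A) :
    ‖X j - z‖ ^ 2 / 2 - ‖X i - z‖ ^ 2 / 2 ≤ (j * τ - i * τ) * A := by
  induction j, hij using Nat.le_induction with
  | base => simp
  | succ j hij ih =>
    have h1 := ih fun k hk hkj => hA k hk (hkj.trans j.le_succ)
    have h2 := hA (j + 1) (hij.trans j.le_succ) le_rfl
    have h3 := hX.mem j z
    set a := X j
    set b := X (j + 1)
    rw [inner_smul_left, conj_trivial] at h3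
    have h4 : τ⁻¹ * ⟪a - b, z - b⟫ ≤ A := by linarith
    rw [inv_mul_le_iff₀ hτ] at h4
    -- This expands ‖a - z‖² around b; the term ‖a - b‖² has the favourable sign and is dropped.
    have h5 := norm_sub_sq_real (z - b) (a - b)
    rw [sub_sub_sub_cancel_right, norm_sub_rev z a, norm_sub_rev z b, real_inner_comm] at h5
    have h6 := sq_nonneg ‖a - b‖
    push_cast
    linarith

end IsProximalSequence

/-- The curve is the pointwise limit of piecewise constant interpolations along a fixed nonprincipal
ultrafilter. This yields limits at all times at once, with no extraction of subsequences. -/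
lemma exists_proximal_curve [FiniteDimensional ℝ E] {K : ℝ} (hK : 0 ≤ K) {F : E → ℝ}
    (hF : IsWeaklyConvex K F) (x₀ : E) :
    ∃ x : ℝ → E, x 0 = x₀ ∧
      (∃ C, 0 ≤ C ∧ ∀ s t, 0 ≤ s → s ≤ t →
        ‖x t - x s‖ ≤ (t - s) * (C * Real.exp (2 * K * t))) ∧
      Antitone (fun t => F (x t)) ∧
      ∀ t, 0 ≤ t → ∀ z, ∀ ε > 0, ∀ᶠ s in 𝓝[>] t,
        ‖x s - z‖ ^ 2 / 2 - ‖x t - z‖ ^ 2 / 2 ≤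
          (s - t) * (F z - F (x t) + K / 2 * ‖z - x t‖ ^ 2 + ε) := by
  have hcont := hF.continuous
  obtain ⟨g, hg⟩ := hF.nonempty_weakSubdiff x₀
  -- `M N` is the inverse step; the shift gives 2Kτ ≤ 1 for every N, including N = 0.
  set M : ℕ → ℝ := fun N => N + (2 * K + 1) with hM
  have hM0 : ∀ N, 0 < M N := fun N => by positivity
  have hMK : ∀ N, 2 * K * (M N)⁻¹ ≤ 1 := fun N => by
    rw [← div_eq_mul_inv, div_le_one (hM0 N)]
    have : (0 : ℝ) ≤ N := N.cast_nonneg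
    simp only [hM]
    linarith
  have hseq : ∀ N, ∃ X : ℕ → E, X 0 = x₀ ∧ IsProximalSequence K (M N)⁻¹ F X := fun N => by
    have h1 := mul_nonneg hK (inv_pos.2 (hM0 N)).le
    exact hF.exists_isProximalSequence (inv_pos.2 (hM0 N)) (by linarith [hMK N]) x₀
  choose X hX0 hX using hseq
  set U : Filter ℕ := ((hyperfilter ℕ : Ultrafilter ℕ) : Filter ℕ) with hU
  have hMtop : Tendsto M U atTop :=
    (tendsto_atTop_add_const_right _ _ tendsto_natCast_atTop_atTop).mono_left
      Nat.hyperfilter_le_atTop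
  set idx : ℕ → ℝ → ℕ := fun N t => ⌊t * M N⌋₊ with hidx
  have hidx_mono : ∀ N s t, s ≤ t → idx N s ≤ idx N t := fun N s t hst =>
    Nat.floor_mono (mul_le_mul_of_nonneg_right hst (hM0 N).le)
  have hidx_le : ∀ N t, 0 ≤ t → idx N t * (M N)⁻¹ ≤ t := fun N t ht => by
    rw [← div_eq_mul_inv, div_le_iff₀ (hM0 N)]
    exact Nat.floor_le (mul_nonneg ht (hM0 N).le)
  have hidx_lim : ∀ t, 0 ≤ t → Tendsto (fun N => idx N t * (M N)⁻¹) U (𝓝 t) := fun t ht =>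
    ((tendsto_nat_floor_mul_div_atTop ht).comp hMtop).congr fun N => div_eq_mul_inv _ _
  have hdist : ∀ N t, 0 ≤ t → ∀ i j, i ≤ j → j ≤ idx N t →
      ‖X N j - X N i‖ ≤ (j * (M N)⁻¹ - i * (M N)⁻¹) * (‖g‖ * Real.exp (2 * K * t)) := by
    intro N t ht i j hij hj
    refine ((hX N).norm_sub_le hK (inv_pos.2 (hM0 N)) (hMK N) (by rwa [hX0]) hij).trans ?_
    have hM1 := inv_pos.2 (hM0 N)
    have h1 : (j : ℝ) * (M N)⁻¹ ≤ t := le_trans (by gcongr) (hidx_le N t ht)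
    have h2 : (0 : ℝ) ≤ j * (M N)⁻¹ - i * (M N)⁻¹ := by
      rw [sub_nonneg]; gcongr
    gcongr
  have hlim : ∀ t, ∃ y, Tendsto (fun N => X N (idx N t)) U (𝓝 y) := by
    intro t
    -- For negative t the natural floor is 0, so the curve stays at x₀; this keeps the energy
    -- antitone on all of ℝ.
    set R := max t 0 * (‖g‖ * Real.exp (2 * K * max t 0))
    have hmem : ∀ N, X N (idx N t) ∈ Metric.closedBall x₀ R := by
      intro N
      have h0 : (0 : ℝ) ≤ max t 0 := le_max_right _ _
      have h1 := hdist N (max t 0) h0 0 (idx N t) (Nat.zero_le _)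
        (hidx_mono N _ _ (le_max_left _ _))
      have h2 : (idx N t : ℝ) * (M N)⁻¹ ≤ max t 0 := by
        refine le_trans ?_ (hidx_le N _ h0)
        exact mul_le_mul_of_nonneg_right (Nat.cast_le.2 (hidx_mono N _ _ (le_max_left _ _)))
          (inv_pos.2 (hM0 N)).le
      rw [mem_closedBall_iff_norm]
      rw [hX0, Nat.cast_zero, zero_mul, sub_zero] at h1
      exact h1.trans (mul_le_mul_of_nonneg_right h2 (by positivity))
    obtain ⟨y, -, hy⟩ := (isCompact_closedBall x₀ R).ultrafilter_le_nhds
      ((hyperfilter ℕ).map fun N => X N (idx N t))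
      (le_principal_iff.2 (Filter.mem_map.2 (Filter.mem_of_superset univ_mem fun N _ => hmem N)))
    exact ⟨y, hy⟩
  choose x hx using hlim
  have hlip : ∀ s t, 0 ≤ s → s ≤ t →
      ‖x t - x s‖ ≤ (t - s) * (‖g‖ * Real.exp (2 * K * t)) := by
    intro s t hs hst
    have h1 := ((hx t).sub (hx s)).norm
    have h2 := ((hidx_lim t (hs.trans hst)).sub (hidx_lim s hs)).mul_const
      (‖g‖ * Real.exp (2 * K * t))
    exact le_of_tendsto_of_tendsto' h1 h2 fun N =>
      hdist N t (hs.trans hst) _ _ (hidx_mono N _ _ hst) le_rfl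
  refine ⟨x, ?_, ⟨‖g‖, norm_nonneg g, hlip⟩, ?_, ?_⟩
  · refine tendsto_nhds_unique (hx 0) (tendsto_const_nhds.congr fun N => ?_)
    simp [hidx, hX0]
  · intro s t hst
    refine le_of_tendsto_of_tendsto' ((hcont.tendsto _).comp (hx t)) ((hcont.tendsto _).comp (hx s))
      fun N => ?_
    exact antitone_nat_of_succ_le (f := fun j => F (X N j)) (hX N).le (hidx_mono N s t hst)
  · intro t ht z ε hε
    set φ : E → ℝ := fun y => F z - F y + K / 2 * ‖z - y‖ ^ 2 with hφ
    have hφc : Continuous φ := by fun_prop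
    obtain ⟨r, hr, hball⟩ := Metric.eventually_nhds_iff.1
      ((hφc.tendsto (x t)).eventually_lt_const (lt_add_of_pos_right (φ (x t)) hε))
    -- D bounds the discrete speed up to time t + 1. For s close to t, all iterates with index from
    -- `idx N t` to `idx N s` are then within r of x t, where φ < φ (x t) + ε.
    set D := ‖g‖ * Real.exp (2 * K * (t + 1)) with hD
    have hD0 : 0 ≤ D := by positivity
    have hsmall : ∀ᶠ s in 𝓝[>] t, (s - t) * D < r / 2 := by
      have h := Continuous.tendsto (f := fun s : ℝ => (s - t) * D) (by fun_prop) t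
      rw [sub_self, zero_mul] at h
      exact (h.mono_left nhdsWithin_le_nhds).eventually_lt_const (half_pos hr)
    filter_upwards [hsmall, Ioo_mem_nhdsGT (lt_add_one t)] with s hs hst
    have ht1 : 0 ≤ t + 1 := by linarith
    have hs0 : 0 ≤ s := ht.trans hst.1.le
    have hgap := (hidx_lim s hs0).sub (hidx_lim t ht)
    have hev1 := (hgap.mul_const D).eventually_lt_const hs
    have hev2 := Metric.tendsto_nhds.1 (hx t) (r / 2) (half_pos hr)
    refine le_of_tendsto_of_tendsto ((((hx s).sub_const z).norm.pow 2).div_const 2 |>.sub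
      ((((hx t).sub_const z).norm.pow 2).div_const 2)) (hgap.mul_const (φ (x t) + ε)) ?_
    filter_upwards [hev1, hev2] with N h1 h2
    refine (hX N).half_norm_sq_sub_le (inv_pos.2 (hM0 N)) (hidx_mono N _ _ hst.1.le) ?_
    intro k hk hks
    refine (hball ?_).le
    have h3 := hdist N (t + 1) ht1 _ _ hk (hks.trans (hidx_mono N _ _ hst.2.le))
    have h4 : ((k : ℝ) * (M N)⁻¹ - idx N t * (M N)⁻¹) * D ≤
        (idx N s * (M N)⁻¹ - idx N t * (M N)⁻¹) * D := by
      have := inv_pos.2 (hM0 N)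
      gcongr
    rw [← dist_eq_norm] at h3
    linarith [dist_triangle (X N k) (X N (idx N t)) (x t)]

/-- A curve satisfying the evolution variational inequality at `t` has there, if it is
differentiable, a velocity opposite to a subgradient. -/
lemma neg_mem_weakSubdiff_of_hasDerivAt {K t : ℝ} {F : E → ℝ} {x : ℝ → E} {v : E}
    (hv : HasDerivAt x v t)
    (h : ∀ z, ∀ ε > 0, ∀ᶠ s in 𝓝[>] t, ‖x s - z‖ ^ 2 / 2 - ‖x t - z‖ ^ 2 / 2 ≤
      (s - t) * (F z - F (x t) + K / 2 * ‖z - x t‖ ^ 2 + ε)) :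
    -v ∈ weakSubdiff K F (x t) := by
  intro z
  have hd : HasDerivAt (fun s => ‖x s - z‖ ^ 2 / 2) (2 * ⟪x t - z, v⟫ / 2) t :=
    (hv.sub_const z).norm_sq.div_const 2
  have hslope := (hasDerivWithinAt_iff_tendsto_slope' self_notMem_Ioi).1
    (hd.hasDerivWithinAt (s := Ioi t))
  have hle : 2 * ⟪x t - z, v⟫ / 2 ≤ F z - F (x t) + K / 2 * ‖z - x t‖ ^ 2 := by
    refine le_of_forall_pos_le_add fun ε hε => le_of_tendsto hslope ?_
    filter_upwards [h z ε hε, self_mem_nhdsWithin] with s hs hst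
    rw [slope_def_field, div_le_iff₀ (sub_pos.2 hst)]
    linarith
  rw [← neg_sub z (x t), inner_neg_left, real_inner_comm] at hle
  rw [inner_neg_left]
  linarith

/-- If the energy is differentiable along the curve, a velocity opposite to a subgradient is
opposite to the subgradient of minimal norm. -/
lemma neg_eq_minimal_of_hasDerivAt {K t d : ℝ} {F : E → ℝ} {x : ℝ → E} {v m : E}
    (hv : HasDerivAt x v t) (hd : HasDerivAt (fun s => F (x s)) d t)
    (hvm : -v ∈ weakSubdiff K F (x t)) (hm : m ∈ weakSubdiff K F (x t))
    (hmin : ∀ g ∈ weakSubdiff K F (x t), ‖m‖ ^ 2 ≤ ⟪m, g⟫) : v = -m := by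
  -- Along the curve, F minus the minorant of slope g is minimal at t, so its derivative vanishes
  -- there. Taking g = -v and g = m gives -‖v‖² = ⟪m, v⟫; with ‖m‖² ≤ -⟪m, v⟫ this yields ‖m + v‖² ≤
  -- 0.
  have key : ∀ g ∈ weakSubdiff K F (x t), d = ⟪g, v⟫ := by
    intro g hg
    have h1 := hv.sub_const (x t)
    have h2 : HasDerivAt (fun s => ⟪g, x s - x t⟫) (⟪g, v⟫) t := by
      simpa using (hasDerivAt_const t g).inner ℝ h1
    have h3 := (hd.fun_sub h2).fun_add (h1.norm_sq.const_mul (K / 2))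
    have hmin : IsLocalMin
        (fun s => F (x s) - ⟪g, x s - x t⟫ + K / 2 * ‖x s - x t‖ ^ 2) t := by
      refine Eventually.of_forall fun s => ?_
      have := hg (x s)
      simp only [sub_self, inner_zero_right, norm_zero]
      linarith
    have h4 := hmin.hasDerivAt_eq_zero h3
    rw [sub_self, inner_zero_left] at h4
    linarith
  have h1 := key _ hvm
  have h2 := key _ hm
  have h3 := hmin _ hvm
  rw [inner_neg_left, real_inner_self_eq_norm_sq] at h1
  rw [inner_neg_right] at h3
  have h4 := norm_add_sq_real m v
  have h5 : ‖m + v‖ ^ 2 ≤ 0 := by linarith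
  have h6 : ‖m + v‖ = 0 :=
    pow_eq_zero_iff two_ne_zero |>.1 (le_antisymm h5 (sq_nonneg _))
  exact eq_neg_of_add_eq_zero_right (norm_eq_zero.1 h6)

end ProximalSequence

/-! ### Existence of the flow. -/

section Existence

variable {n : ℕ}

local notation "𝔼" => EuclideanSpace ℝ (Fin n)

lemma IsWeaklyConvex.exists_isProximalFlowOn {K : ℝ} (hK : 0 ≤ K) {F : 𝔼 → ℝ}
    (hF : IsWeaklyConvex K F) (x₀ : 𝔼) :
    ∃ x : ℝ → 𝔼, x 0 = x₀ ∧ ∀ T, 0 < T → IsProximalFlowOn F T x := by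
  obtain ⟨x, hx0, ⟨C, hC, hlip⟩, hanti, hevi⟩ := exists_proximal_curve hK hF x₀
  refine ⟨x, hx0, fun T hT => ?_⟩
  have hac : AbsolutelyContinuousOnInterval x 0 T := by
    refine LipschitzOnWith.absolutelyContinuousOnInterval
      (K := (C * Real.exp (2 * K * T)).toNNReal) (LipschitzOnWith.of_dist_le_mul ?_)
    have hle : ∀ s t, 0 ≤ s → s ≤ t → t ≤ T →
        ‖x t - x s‖ ≤ C * Real.exp (2 * K * T) * (t - s) := by
      intro s t hs hst htT
      refine (hlip s t hs hst).trans ?_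
      rw [mul_comm]
      have := sub_nonneg.2 hst
      gcongr
    rw [uIcc_of_le hT.le, Real.coe_toNNReal _ (by positivity)]
    intro a ha b hb
    rcases le_total a b with hab | hab
    · rw [dist_comm, dist_comm a b, dist_eq_norm, Real.dist_eq, abs_of_nonneg (sub_nonneg.2 hab)]
      exact hle a b ha.1 hab hb.2
    · rw [dist_eq_norm, Real.dist_eq, abs_of_nonneg (sub_nonneg.2 hab)]
      exact hle b a hb.1 hab ha.2
  refine ⟨hac, ?_⟩
  rw [ae_restrict_iff' measurableSet_Icc]
  -- Lebesgue's theorem on monotone functions differentiates the energy almost everywhere, so no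
  -- chain rule for F is needed.
  have hmono : Monotone fun t => -F (x t) := fun s t hst => neg_le_neg (hanti hst)
  filter_upwards [hac.boundedVariationOn.ae_differentiableAt_of_mem_uIcc,
    hmono.ae_differentiableAt] with t h1 h2 ht
  have hv := (h1 (by rwa [uIcc_of_le hT.le])).hasDerivAt
  have hd : DifferentiableAt ℝ (fun t => F (x t)) t := by simpa using h2.fun_neg
  obtain ⟨m, hm, hmin⟩ := hF.exists_minimal (x t)
  have hvm := neg_mem_weakSubdiff_of_hasDerivAt hv (hevi t ht.1)
  refine ⟨_, hv, ?_⟩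
  rw [neg_eq_minimal_of_hasDerivAt hv hd.hasDerivAt hvm hm hmin]
  exact hF.isProxVelocity_neg hm hmin

end Existence

/-! ### Weak convexity of smooth plus convex functions. -/

section Smooth

/-- On each line the derivative of f + K/2 ‖·‖² is monotone: the quadratic term grows at least as
fast as the gradient of f can decrease. -/
lemma isWeaklyConvex_of_gradient_lipschitz {E : Type*} [NormedAddCommGroup E]
    [InnerProductSpace ℝ E] [CompleteSpace E] {K : ℝ} {f : E → ℝ} (hd : Differentiable ℝ f)
    (hL : ∀ x y, ‖gradient f x - gradient f y‖ ≤ K * ‖x - y‖) : IsWeaklyConvex K f := by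
  refine ⟨convex_univ, fun x _ y _ a b ha hb hab => ?_⟩
  set v := y - x with hv
  set φ : ℝ → ℝ := fun t => f (x + t • v) + K / 2 * ‖x + t • v‖ ^ 2 with hφ
  have hφd : ∀ t, HasDerivAt φ (⟪gradient f (x + t • v), v⟫ + K * ⟪x + t • v, v⟫) t := by
    intro t
    have h1 : HasDerivAt (fun t : ℝ => x + t • v) v t := by
      simpa using ((hasDerivAt_id t).smul_const v).const_add x
    have h2 := (hd (x + t • v)).hasGradientAt.hasFDerivAt.comp_hasDerivAt t h1
    have h3 := h2.fun_add (h1.norm_sq.const_mul (K / 2))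
    refine h3.congr_deriv ?_
    rw [InnerProductSpace.toDual_apply_apply]
    ring
  have hmono : Monotone (deriv φ) := by
    intro s t hst
    rw [(hφd s).deriv, (hφd t).deriv]
    have h1 := hL (x + t • v) (x + s • v)
    have h2 := neg_le_of_abs_le
      (abs_real_inner_le_norm (gradient f (x + t • v) - gradient f (x + s • v)) v)
    have e : x + t • v - (x + s • v) = (t - s) • v := by module
    rw [e, norm_smul, Real.norm_of_nonneg (sub_nonneg.2 hst)] at h1
    have h3 := mul_le_mul_of_nonneg_right h1 (norm_nonneg v)
    have h4 : ⟪x + t • v, v⟫ - ⟪x + s • v, v⟫ = (t - s) * (‖v‖ * ‖v‖) := by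
      rw [← inner_sub_left, e, inner_smul_left, conj_trivial, real_inner_self_eq_norm_mul_norm]
    have h5 : K * ⟪x + t • v, v⟫ - K * ⟪x + s • v, v⟫ = K * ((t - s) * (‖v‖ * ‖v‖)) := by
      rw [← mul_sub, h4]
    rw [inner_sub_left] at h2
    linarith
  have hconv := hmono.convexOn_univ_of_deriv fun t => (hφd t).differentiableAt
  have h := hconv.2 (mem_univ 0) (mem_univ 1) ha hb hab
  have e : a • x + b • y = x + b • v := by
    obtain rfl : a = 1 - b := by linarith
    rw [hv]; module
  have e1 : x + v = y := by rw [hv]; abel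
  rw [e]
  simpa [hφ, e1] using h

/-- The absolute value supplies the nonnegative constant that the discrete estimates require, since
no sign of L is assumed. -/
lemma IsLSmooth.isWeaklyConvex_add {n : ℕ} {L : ℝ} {f h : EuclideanSpace ℝ (Fin n) → ℝ}
    (hf : IsLSmooth L f) (hh : ConvexOn ℝ univ h) : IsWeaklyConvex |L| (f + h) := by
  have h1 : IsWeaklyConvex |L| f := isWeaklyConvex_of_gradient_lipschitz hf.1 fun x y =>
    (hf.2 x y).trans (mul_le_mul_of_nonneg_right (le_abs_self L) (norm_nonneg _))
  refine (ConvexOn.add h1 hh).congr fun x _ => ?_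
  simp only [Pi.add_apply]
  ring

end Smooth

end ProxFlow

theorem mainTheorem7 (n : ℕ) (L : ℝ) (f h : EuclideanSpace ℝ (Fin n) → ℝ)
    (hf : ProxFlow.IsLSmooth L f) (hh : ConvexOn ℝ Set.univ h) :
    (∀ x : EuclideanSpace ℝ (Fin n), ∃ v : EuclideanSpace ℝ (Fin n),
      ProxFlow.IsProxVelocity (f + h) x v ∧
      -v ∈ ProxFlow.clarkeSubdifferential (f + h) x) ∧
    ∀ x₀ : EuclideanSpace ℝ (Fin n), ∃ x : ℝ → EuclideanSpace ℝ (Fin n),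
      x 0 = x₀ ∧
      (∀ T : ℝ, 0 < T →
        ProxFlow.IsProximalFlowOn (f + h) T x ∧ ProxFlow.IsSubgradientFlowOn (f + h) T x) ∧
      (∀ T : ℝ, 0 < T → ∀ y : ℝ → EuclideanSpace ℝ (Fin n), y 0 = x₀ →
        ProxFlow.IsProximalFlowOn (f + h) T y → Set.EqOn y x (Set.Icc 0 T)) ∧
      (∀ T : ℝ, 0 < T → ∀ y : ℝ → EuclideanSpace ℝ (Fin n), y 0 = x₀ →
        ProxFlow.IsSubgradientFlowOn (f + h) T y → Set.EqOn y x (Set.Icc 0 T)) := by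
  have hF := hf.isWeaklyConvex_add hh
  refine ⟨fun x => ?_, fun x₀ => ?_⟩
  · obtain ⟨m, hm, hmin⟩ := hF.exists_minimal x
    have hv := hF.isProxVelocity_neg hm hmin
    exact ⟨-m, hv, hF.neg_mem_of_isProxVelocity hv⟩
  · obtain ⟨x, hx0, hx⟩ := hF.exists_isProximalFlowOn (abs_nonneg L) x₀
    have hx' := fun T hT => (hx T hT).isSubgradientFlowOn hF
    exact ⟨x, hx0, fun T hT => ⟨hx T hT, hx' T hT⟩,
      fun T hT y hy0 hy => (hx' T hT).eqOn hF (hy.isSubgradientFlowOn hF) (hy0.trans hx0.symm),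
      fun T hT y hy0 hy => (hx' T hT).eqOn hF hy (hy0.trans hx0.symm)⟩
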